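/- Let $k$ be an algebraically closed field, let $n\ge 1$, and let $p_1,\dots,p_s$ with $1\le s\le n+3$ be points in general position in $\mathbb{P}^n_k$, meaning that any at most $n+1$ of them are linearly independent (represented by linearly independent vectors of $k^{n+1}$). Let $J_{n,0,s}\subset k[x_0,\dots,x_n]$ be the ideal generated by all forms that vanish at $p_1,\dots,p_s$. For a nonzero homogeneous ideal $J$, let $\alpha(J)$ be the least degree of a nonzero form in $J$, let $J^{(m)}=\bigcap_{P\in\mathrm{Ass}(k[x_0,\dots,x_n]/J)}\bigl(J^m k[x_0,\dots,x_n]_P\cap k[x_0,\dots,x_n]\bigr)$ be the $m$th symbolic power of $J$, and let $$\gamma(J)=\lim_{m\to\infty}\frac{\alpha(J^{(m)})}{m}=\inf_{m\ge 1}\frac{\alpha(J^{(m)})}{m}$$ be its Waldschmidt constant. Then (the limit exists, equals the infimum, and) $$\gamma(J_{n,0,s})=\begin{cases}1, & s\le n;\\ 1+\frac1n, & s=n+1;\\ 1+\frac2n, & s=n+2;\\ 1+\frac2n, & s=n+3,\ n\text{ even};\\ 1+\frac2n+\frac{2}{n^3+2n^2-n}, & s=n+3,\ n\text{ odd}.\end{cases}$$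 -/

import Mathlib

open Filter Topology
open scoped LinearAlgebra.Projectivization

noncomputable section

namespace Waldschmidt

/-- The `m`-th symbolic power `J^(m) = ⋂_{P ∈ Ass(R/J)} (J^m R_P ∩ R)` of an ideal `J` of a
(Noetherian) commutative ring `R`; here `J^m R_P ∩ R` is the preimage in `R` of the extension of
`J^m` to the localization `R_P`. -/
def symbolicPower {R : Type*} [CommRing R] (J : Ideal R) (m : ℕ) : Ideal R :=
  ⨅ (P : Ideal R) (hP : P ∈ associatedPrimes R (R ⧸ J)),
    haveI : P.IsPrime := IsAssociatedPrime.isPrime hP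
    Ideal.comap (algebraMap R (Localization.AtPrime P))
      (Ideal.map (algebraMap R (Localization.AtPrime P)) (J ^ m))

/-- `α(J)`: the least degree of a nonzero form in the nonzero homogeneous ideal `J`. -/
def initialDegree {k : Type*} [Field k] {n : ℕ} (J : Ideal (MvPolynomial (Fin (n + 1)) k)) : ℕ :=
  sInf {t : ℕ | ∃ f ∈ J, f ≠ 0 ∧ f.IsHomogeneous t}

/-- `c` is the Waldschmidt constant `γ(J)`, that is
`c = lim_{m → ∞} α(J^(m)) / m = inf_{m ≥ 1} α(J^(m)) / m`. -/
structure IsWaldschmidtConstant {k : Type*} [Field k] {n : ℕ}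
    (J : Ideal (MvPolynomial (Fin (n + 1)) k)) (c : ℝ) : Prop where
  tendsto : Tendsto (fun m : ℕ => (initialDegree (symbolicPower J m) : ℝ) / m) atTop (𝓝 c)
  isGLB : IsGLB {x : ℝ | ∃ m : ℕ, 1 ≤ m ∧ x = (initialDegree (symbolicPower J m) : ℝ) / m} c

/-- The homogeneous ideal of a set `X` of points of `ℙⁿ`: the ideal generated by all forms that
vanish at every point of `X`. A form vanishes at a point when it vanishes on the line of
`kⁿ⁺¹` which that point is. -/
def pointsIdeal {k : Type*} [Field k] {n : ℕ} (X : Set (ℙ k (Fin (n + 1) → k))) :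
    Ideal (MvPolynomial (Fin (n + 1)) k) :=
  Ideal.span {f | (∃ d : ℕ, f.IsHomogeneous d) ∧
    ∀ P ∈ X, ∀ v ∈ P.submodule, MvPolynomial.eval v f = 0}

/-- The points `p 0, …, p (s - 1)` of `ℙⁿ` are in (linearly) general position: any at most `n + 1`
of them are linearly independent. -/
def InGeneralPosition {k : Type*} [Field k] {n s : ℕ} (p : Fin s → ℙ k (Fin (n + 1) → k)) : Prop :=
  ∀ T : Finset (Fin s), T.card ≤ n + 1 → Projectivization.Independent (fun i : T => p i)

end Waldschmidt

end

/-! A form lies in `J^(m)` exactly when it vanishes to order `m` at every point, so `γ(J)` is the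
least asymptotic ratio of degree to multiplicity. Each case needs a bound `c * m ≤ t` and one form
attaining it; the powers of that form then give both the limit and the infimum
(`isWaldschmidtConstant_of_bounds`).

The main tool is the Cremona map `x ↦ q / x` centred at `n + 1` of the points (`exists_cremona`).
Write the multiplicity at the `i`-th point as `t - d i`. The map keeps each `d i` at the centres and
replaces `t` by `∑ d i - t`, summed over the centres. The new degree is nonnegative, which bounds
`t`; applied to the constant form `1`, the map produces extremal forms.

A suitable `q` fixes one further point, or swaps two further points. For `n + 3` points the swap
preserves the configuration and the number `δ = ∑ d i - 2 t`, and sends `d i` to `δ - d i` at the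
swapped points. Such flips compose to a flip on any even set of points (`HasForm.flip`). For `n`
odd, flipping all `n + 3` points gives both the bound and the extremal form. For `n` even, `n + 2`
of the points already force the bound, and flipping `n + 2` points yields a form attaining it. For
`s = n + 2` the extremal form is a product of hyperplanes through `n` of the points. -/

namespace Waldschmidt

open MvPolynomial

universe u

/-! ### Order of vanishing at a point, in any characteristic -/

section Order

variable {k : Type u} [Field k] {σ : Type}

/-- `f` vanishes to order at least `m` along the line spanned by `v`: the polynomial
`f (c v + T Y)` is divisible by `T ^ m`, for all values of `c`, `T`, `Y` in all `k`-algebras. -/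
def VanishesToOrder (v : σ → k) (m : ℕ) (f : MvPolynomial σ k) : Prop :=
  ∀ (B : Type u) [CommRing B] [Algebra k B] (c T : B) (Y : σ → B),
    T ^ m ∣ aeval (fun i => c * algebraMap k B (v i) + T * Y i) f

/-- The point `c v + T Y` with `T`, `c` and `Y` independent variables. -/
noncomputable def genericPoint (v : σ → k) (i : σ) : MvPolynomial (Option (Option σ)) k :=
  X (some none) * algebraMap k _ (v i) + X none * X (some (some i))

/-- All `c`, `T`, `Y` are specializations of independent variables, so one divisibility in a
polynomial ring suffices. There `T` is prime and can be cancelled. -/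
theorem vanishesToOrder_iff_generic {v : σ → k} {m : ℕ} {f : MvPolynomial σ k} :
    VanishesToOrder v m f ↔ (X none) ^ m ∣ aeval (genericPoint v) f := by
  refine ⟨fun h => h _ _ _ _, fun h B _ _ c T Y => ?_⟩
  have h2 := map_dvd (aeval (R := k) (fun o : Option (Option σ) =>
    o.elim T (fun o' => o'.elim c Y))) h
  rw [map_pow, MvPolynomial.comp_aeval_apply] at h2
  simpa [genericPoint] using h2

namespace VanishesToOrder

variable {v : σ → k} {m m' t : ℕ} {f g : MvPolynomial σ k}

theorem dvd_aeval (h : VanishesToOrder v m f) {B : Type u} [CommRing B] [Algebra k B] {c T : B}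
    {x : σ → B} (hx : ∀ i, T ∣ x i - c * algebraMap k B (v i)) : T ^ m ∣ aeval x f := by
  choose Y hY using hx
  have : x = fun i => c * algebraMap k B (v i) + T * Y i := by
    funext i
    rw [← hY i]
    ring
  rw [this]
  exact h B c T Y

theorem zero (f : MvPolynomial σ k) : VanishesToOrder v 0 f := fun B _ _ c T Y => by simp

theorem mono (h : VanishesToOrder v m f) (hm : m' ≤ m) : VanishesToOrder v m' f :=
  fun B _ _ c T Y => (pow_dvd_pow T hm).trans (h B c T Y)

theorem mul (hf : VanishesToOrder v m f) (hg : VanishesToOrder v m' g) :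
    VanishesToOrder v (m + m') (f * g) := fun B _ _ c T Y => by
  rw [pow_add, map_mul]
  exact mul_dvd_mul (hf B c T Y) (hg B c T Y)

theorem of_dvd (hf : VanishesToOrder v m f) (h : f ∣ g) : VanishesToOrder v m g := by
  obtain ⟨c, rfl⟩ := h
  simpa using hf.mul (zero c)

theorem pow (hf : VanishesToOrder v m f) (j : ℕ) : VanishesToOrder v (m * j) (f ^ j) := by
  induction j with
  | zero => exact zero _
  | succ j ih => exact ih.mul hf

theorem prod {ι : Type*} (s : Finset ι) (F : ι → MvPolynomial σ k)
    (h : ∀ i ∈ s, VanishesToOrder v 1 (F i)) : VanishesToOrder v s.card (∏ i ∈ s, F i) := by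
  classical
  induction s using Finset.induction_on with
  | empty => exact zero _
  | insert a s ha ih =>
    rw [Finset.card_insert_of_notMem ha, Finset.prod_insert ha, add_comm]
    exact (h a (by simp)).mul (ih fun i hi => h i (by simp [hi]))

end VanishesToOrder

theorem aeval_homogeneous_mul {f : MvPolynomial σ k} {t : ℕ} (hf : f.IsHomogeneous t) {B : Type*}
    [CommRing B] [Algebra k B] (T : B) (Y : σ → B) :
    aeval (fun i => T * Y i) f = T ^ t * aeval Y f := by
  rw [aeval_def, aeval_def, eval₂_eq, eval₂_eq, Finset.mul_sum]
  refine Finset.sum_congr rfl fun a ha => ?_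
  have : ∑ i ∈ a.support, a i = t := by
    rw [← hf.degree_eq_sum_deg_support ha]
  rw [← this, ← Finset.prod_pow_eq_pow_sum]
  simp_rw [mul_pow, Finset.prod_mul_distrib]
  ring

theorem VanishesToOrder.le_degree {v : σ → k} {m t : ℕ} {f : MvPolynomial σ k}
    (h : VanishesToOrder v m f) (hf : f.IsHomogeneous t) (hf0 : f ≠ 0) : m ≤ t := by
  -- With `c = 0` the point is `T X`, and `f (T X) = T ^ t * f`.
  have h1 := h (Polynomial (MvPolynomial σ k)) 0 Polynomial.X (fun i => Polynomial.C (X i))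
  simp only [zero_mul, zero_add] at h1
  rw [aeval_homogeneous_mul hf] at h1
  have h2 : aeval (fun i => Polynomial.C (X i)) f = Polynomial.C f := by
    have := MvPolynomial.comp_aeval_apply (R := k) (σ := σ) X
      (IsScalarTower.toAlgHom k (MvPolynomial σ k) (Polynomial (MvPolynomial σ k))) f
    simpa [aeval_X_left] using this.symm
  rw [h2, Polynomial.X_pow_dvd_iff] at h1
  by_contra hlt
  have := h1 t (by omega)
  rw [mul_comm, Polynomial.coeff_C_mul_X_pow] at this
  simp [hf0] at this

theorem sum_eq_of_mem_support [Fintype σ] {f : MvPolynomial σ k} {t : ℕ} (hf : f.IsHomogeneous t)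
    {a : σ →₀ ℕ} (ha : a ∈ f.support) : ∑ i, a i = t := by
  rw [← Finsupp.degree_eq_sum, hf.degree_eq_sum_deg_support ha, Finsupp.degree_apply]

theorem le_of_mem_support [Fintype σ] {f : MvPolynomial σ k} {t : ℕ} (hf : f.IsHomogeneous t)
    {a : σ →₀ ℕ} (ha : a ∈ f.support) (i : σ) : a i ≤ t := by
  rw [← sum_eq_of_mem_support hf ha]
  exact Finset.single_le_sum (fun _ _ => Nat.zero_le _) (Finset.mem_univ i)

/-- Vanishing at a coordinate point, in terms of exponents. -/
theorem vanishesToOrder_single_iff [Fintype σ] [DecidableEq σ] {i : σ} {m t : ℕ}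
    {f : MvPolynomial σ k}
    (hf : f.IsHomogeneous t) :
    VanishesToOrder (Pi.single i 1) m f ↔ ∀ a ∈ f.support, a i + m ≤ t := by
  constructor
  · intro h a ha
    -- With `Y i = 0` the monomial of exponent `a` acquires exactly the factor `T ^ (t - a i)`. No
    -- two monomials collide, since `a` is recovered from `t` and its entries away from `i`.
    have h1 := h (Polynomial (MvPolynomial σ k)) 1 Polynomial.X
      (fun j => if j = i then 0 else Polynomial.C (X j))
    rw [Polynomial.X_pow_dvd_iff] at h1
    have key : ∀ b ∈ f.support, (algebraMap k (Polynomial (MvPolynomial σ k))) (coeff b f) *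
        ∏ j, (1 * algebraMap k (Polynomial (MvPolynomial σ k)) ((Pi.single i 1 : σ → k) j) +
          Polynomial.X * (if j = i then 0 else Polynomial.C (X j))) ^ b j =
        Polynomial.C (monomial (b.erase i) (coeff b f)) * Polynomial.X ^ (t - b i) := by
      intro b hb
      have e1 : t - b i = ∑ j ∈ Finset.univ.erase i, b j := by
        rw [← sum_eq_of_mem_support hf hb, ← Finset.add_sum_erase _ _ (Finset.mem_univ i)]
        simp
      rw [← Finset.mul_prod_erase _ _ (Finset.mem_univ i), e1, ← Finset.prod_pow_eq_pow_sum,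
        monomial_eq, Finsupp.prod_fintype _ _ (fun _ => pow_zero _), map_mul, map_prod,
        ← Finset.mul_prod_erase Finset.univ (fun j => Polynomial.C (X j ^ (b.erase i) j))
          (Finset.mem_univ i), mul_assoc]
      have e2 : ∀ j ∈ Finset.univ.erase i,
          (1 * algebraMap k (Polynomial (MvPolynomial σ k)) ((Pi.single i 1 : σ → k) j) +
          Polynomial.X * (if j = i then 0 else Polynomial.C (X j))) ^ b j =
          Polynomial.C (X j ^ (b.erase i) j) * Polynomial.X ^ b j := by
        intro j hj
        have hj' := Finset.ne_of_mem_erase hj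
        rw [Pi.single_eq_of_ne hj', Finsupp.erase_ne hj', if_neg hj', map_zero, mul_zero, zero_add,
          mul_pow, mul_comm, map_pow]
      rw [Finset.prod_congr rfl e2, Finset.prod_mul_distrib]
      simp [Polynomial.algebraMap_apply]
    by_contra hlt
    have hai := le_of_mem_support hf ha i
    have h2 := h1 (t - a i) (by omega)
    rw [aeval_def, eval₂_eq', Finset.sum_congr rfl key, Polynomial.finsetSum_coeff] at h2
    simp_rw [Polynomial.coeff_C_mul_X_pow] at h2
    have h3 := congrArg (coeff (a.erase i)) h2
    rw [coeff_sum, Finset.sum_eq_single a] at h3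
    · simp at h3
      exact (mem_support_iff.mp ha) h3
    · intro b hb hba
      split_ifs with hc
      · rw [coeff_monomial, if_neg]
        intro he
        apply hba
        ext j
        by_cases hj : j = i
        · have := le_of_mem_support hf ha i
          have := le_of_mem_support hf hb i
          rw [hj]
          omega
        · have := DFunLike.congr_fun he j
          rwa [Finsupp.erase_ne hj, Finsupp.erase_ne hj] at this
      · simp
    · exact fun h => absurd ha h
  · intro h B _ _ c T Y
    rw [aeval_def, eval₂_eq']
    refine Finset.dvd_sum fun a ha => Dvd.dvd.mul_left ?_ _
    have hd := sum_eq_of_mem_support hf ha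
    rw [← Finset.mul_prod_erase _ _ (Finset.mem_univ i)]
    refine Dvd.dvd.mul_left ?_ _
    have e : T ^ m ∣ T ^ (∑ j ∈ Finset.univ.erase i, a j) := by
      apply pow_dvd_pow
      have := h a ha
      rw [← Finset.add_sum_erase _ _ (Finset.mem_univ i)] at hd
      omega
    refine e.trans ?_
    rw [← Finset.prod_pow_eq_pow_sum]
    refine Finset.prod_dvd_prod_of_dvd _ _ fun j hj => pow_dvd_pow_of_dvd ?_ _
    simp [Finset.ne_of_mem_erase hj]

end Order

/-! ### The Cremona map at the coordinate points -/

section Cremona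

variable {k : Type u} [Field k] {σ : Type} [Fintype σ]

/-- The transform of `f` under the Cremona map `x ↦ q / x`, with denominators cleared by the
monomial of exponent `d`. -/
noncomputable def cremona (q : σ → k) (d : σ →₀ ℕ) (f : MvPolynomial σ k) : MvPolynomial σ k :=
  ∑ a ∈ f.support, monomial (d - a) (coeff a f * ∏ i, q i ^ a i)

theorem cremona_isHomogeneous (q : σ → k) (d : σ →₀ ℕ) {f : MvPolynomial σ k} {t : ℕ}
    (hf : f.IsHomogeneous t) (hd : ∀ a ∈ f.support, a ≤ d) :
    (cremona q d f).IsHomogeneous (∑ i, d i - t) := by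
  refine IsHomogeneous.sum _ _ _ fun a ha => isHomogeneous_monomial _ ?_
  rw [Finsupp.degree_eq_sum, ← sum_eq_of_mem_support hf ha, eq_tsub_iff_add_eq_of_le
    (Finset.sum_le_sum fun i _ => hd a ha i), ← Finset.sum_add_distrib]
  exact Finset.sum_congr rfl fun i _ => tsub_add_cancel_of_le (hd a ha i)

theorem coeff_cremona (q : σ → k) {d : σ →₀ ℕ} {f : MvPolynomial σ k}
    (hd : ∀ a ∈ f.support, a ≤ d) {a : σ →₀ ℕ} (ha : a ∈ f.support) :
    coeff (d - a) (cremona q d f) = coeff a f * ∏ i, q i ^ a i := by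
  classical
  rw [cremona, coeff_sum, Finset.sum_eq_single a]
  · simp
  · intro b hb hba
    rw [coeff_monomial, if_neg]
    intro he
    apply hba
    rw [← tsub_tsub_cancel_of_le (hd b hb), he, tsub_tsub_cancel_of_le (hd a ha)]
  · exact fun h => absurd ha h

theorem cremona_ne_zero {q : σ → k} (hq : ∀ i, q i ≠ 0) {d : σ →₀ ℕ} {f : MvPolynomial σ k}
    (hf : f ≠ 0) (hd : ∀ a ∈ f.support, a ≤ d) : cremona q d f ≠ 0 := by
  obtain ⟨a, ha⟩ := support_nonempty.mpr hf
  intro h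
  have h1 := coeff_cremona q hd ha
  rw [h, coeff_zero] at h1
  exact mul_ne_zero (mem_support_iff.mp ha) (Finset.prod_ne_zero_iff.mpr fun i _ =>
    pow_ne_zero _ (hq i)) h1.symm

/-- This is `g x = x ^ d * f (q / x)` without division: `π` serves as a common denominator of the `q
i / x i`. -/
theorem aeval_cremona {q : σ → k} {d : σ →₀ ℕ} {f : MvPolynomial σ k} {t : ℕ}
    (hf : f.IsHomogeneous t) (hd : ∀ a ∈ f.support, a ≤ d) {B : Type*} [CommRing B] [Algebra k B]
    {x x' : σ → B} {π : B} (hx : ∀ i, x i * x' i = π * algebraMap k B (q i)) :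
    π ^ t * aeval x (cremona q d f) = (∏ i, x i ^ d i) * aeval x' f := by
  rw [aeval_def x', eval₂_eq', cremona, map_sum, Finset.mul_sum, Finset.mul_sum]
  refine Finset.sum_congr rfl fun a ha => ?_
  rw [aeval_monomial, Finsupp.prod_fintype _ _ (fun _ => pow_zero _), map_mul, map_prod,
    ← sum_eq_of_mem_support hf ha, ← Finset.prod_pow_eq_pow_sum]
  have h1 : (∏ i, π ^ a i) * ∏ i, algebraMap k B (q i ^ a i) =
      (∏ i, x i ^ a i) * ∏ i, x' i ^ a i := by
    rw [← Finset.prod_mul_distrib, ← Finset.prod_mul_distrib]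
    refine Finset.prod_congr rfl fun i _ => ?_
    rw [map_pow, ← mul_pow, ← hx i, mul_pow]
  have h2 : (∏ i, x i ^ d i) = (∏ i, x i ^ (d - a) i) * ∏ i, x i ^ a i := by
    rw [← Finset.prod_mul_distrib]
    refine Finset.prod_congr rfl fun i _ => ?_
    rw [← pow_add]
    congr 1
    exact (tsub_add_cancel_of_le (hd a ha i)).symm
  rw [h2]
  linear_combination (algebraMap k B (coeff a f) * ∏ i, x i ^ (d - a) i) * h1

theorem dvd_prod_sub_prod {ι B : Type*} [CommRing B] {T : B} (s : Finset ι) {x y : ι → B}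
    (h : ∀ i ∈ s, T ∣ x i - y i) : T ∣ ∏ i ∈ s, x i - ∏ i ∈ s, y i := by
  simp_rw [← Ideal.mem_span_singleton, ← Ideal.Quotient.eq, map_prod] at h ⊢
  exact Finset.prod_congr rfl h

theorem X_none_not_dvd_prod_genericPoint {w : σ → k} (hw : ∀ i, w i ≠ 0) :
    ¬ (X none : MvPolynomial (Option (Option σ)) k) ∣ ∏ i, genericPoint w i := by
  rw [X_prime.dvd_finsetProd_iff]
  rintro ⟨i, -, h⟩
  have h2 := map_dvd (aeval (R := k) (fun o : Option (Option σ) => o.elim (0 : k) 1)) h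
  simp [genericPoint, hw i] at h2

theorem VanishesToOrder.cremona [DecidableEq σ] {q : σ → k} (hq : ∀ i, q i ≠ 0) {d : σ →₀ ℕ}
    {f : MvPolynomial σ k} {t r : ℕ} (hf : f.IsHomogeneous t) (hd : ∀ a ∈ f.support, a ≤ d)
    {w w' : σ → k} (hw : ∀ i, w i * w' i = q i) (h : VanishesToOrder w r f) :
    VanishesToOrder w' r (cremona q d f) := by
  rw [vanishesToOrder_iff_generic]
  set A := MvPolynomial (Option (Option σ)) k
  have hw' : ∀ i, w' i ≠ 0 := fun i hi => hq i (by rw [← hw i, hi, mul_zero])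
  -- Take `π = ∏ x j`, where `x` is the generic point near `w'`. The coordinates of `w'` are
  -- nonzero, so `T` does not divide `π` and `π ^ t` cancels.
  refine X_prime.pow_dvd_of_dvd_mul_left r
    (a := (∏ i, genericPoint w' i) ^ t)
    (fun h => X_none_not_dvd_prod_genericPoint hw' (X_prime.dvd_of_dvd_pow h)) ?_
  rw [aeval_cremona hf hd (x' := fun i => algebraMap k A (q i) *
    ∏ j ∈ Finset.univ.erase i, genericPoint w' j)]
  · refine Dvd.dvd.mul_left ?_ _
    -- Modulo `T`, the image point is only a multiple of `w`; this `c` is the factor.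
    refine h.dvd_aeval (c := X (some none) ^ (Fintype.card σ - 1) * algebraMap k A (∏ j, w' j))
      fun i => ?_
    have e : X (some none) ^ (Fintype.card σ - 1) * algebraMap k A (∏ j, w' j) *
        algebraMap k A (w i) = algebraMap k A (q i) *
          ∏ j ∈ Finset.univ.erase i, (X (some none) * algebraMap k A (w' j)) := by
      rw [Finset.prod_mul_distrib, Finset.prod_const, Finset.card_erase_of_mem (Finset.mem_univ i),
        Finset.card_univ, ← map_prod, ← Finset.mul_prod_erase _ _ (Finset.mem_univ i), ← hw i]
      simp only [map_mul]
      ring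
    rw [e, ← mul_sub]
    refine Dvd.dvd.mul_left (dvd_prod_sub_prod _ fun j _ => ?_) _
    rw [genericPoint, add_sub_cancel_left]
    exact dvd_mul_right _ _
  · intro i
    rw [← Finset.mul_prod_erase _ _ (Finset.mem_univ i)]
    ring

/-- The Cremona transformation centred at the coordinate points. -/
theorem exists_cremona_single [DecidableEq σ] {q : σ → k} (hq : ∀ i, q i ≠ 0)
    {f : MvPolynomial σ k} {t : ℕ} (hf : f.IsHomogeneous t) (hf0 : f ≠ 0) {d : σ → ℤ}
    (hd : ∀ i, VanishesToOrder (Pi.single i 1) (t - d i).toNat f) :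
    ∃ (t' : ℕ) (g : MvPolynomial σ k), g.IsHomogeneous t' ∧ g ≠ 0 ∧ (t' : ℤ) = ∑ i, d i - t ∧
      (∀ i, VanishesToOrder (Pi.single i 1) (t' - d i).toNat g) ∧
      ∀ (w w' : σ → k) (r : ℕ), (∀ i, w i * w' i = q i) → VanishesToOrder w r f →
        VanishesToOrder w' r g := by
  -- A multiplicity never exceeds the degree, so the `d i` are natural numbers; `d i > t` imposes no
  -- condition.
  have hd0 : ∀ i, 0 ≤ d i := fun i => by
    have := (hd i).le_degree hf hf0
    omega
  lift d to σ → ℕ using hd0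
  set D : σ →₀ ℕ := Finsupp.equivFunOnFinite.symm d with hD
  -- Multiplicity `t - d i` at the `i`-th coordinate point says that `x i` has exponent at most `d
  -- i`. The substitution `a ↦ d - a` keeps this bound, hence keeps `d`.
  have hle : ∀ a ∈ f.support, a ≤ D := fun a ha i => by
    have : a i + ((t : ℤ) - d i).toNat ≤ t := (vanishesToOrder_single_iff hf).1 (hd i) a ha
    change a i ≤ d i
    omega
  have hsum : t ≤ ∑ i, d i := by
    obtain ⟨a, ha⟩ := support_nonempty.mpr hf0
    rw [← sum_eq_of_mem_support hf ha]
    exact Finset.sum_le_sum fun i _ => hle a ha i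
  have hg := cremona_isHomogeneous q D hf hle
  have ht' : ∑ i, D i = ∑ i, d i := rfl
  refine ⟨_, _, hg, cremona_ne_zero hq hf0 hle, ?_, fun i => ?_, fun w w' r hw h =>
    h.cremona hq hf hle hw⟩
  · rw [ht']
    push_cast [hsum]
    rfl
  · rw [vanishesToOrder_single_iff hg]
    intro b hb
    have hb1 : b i ≤ d i := by
      obtain ⟨a, ha, hba⟩ := Finset.mem_biUnion.mp (support_sum hb)
      have := Finset.mem_singleton.mp (support_monomial_subset hba)
      rw [this]
      exact tsub_le_self
    have := le_of_mem_support hg hb i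
    beta_reduce
    omega

end Cremona

/-! ### Transport to an arbitrary basis -/

section LinearChange

variable {k : Type u} [Field k] {σ : Type} [Fintype σ]

/-- Substitution of `x ᵥ* M` for `x`. -/
noncomputable def linearChange (M : Matrix σ σ k) : MvPolynomial σ k →ₐ[k] MvPolynomial σ k :=
  aeval fun i => ∑ j, C (M j i) * X j

theorem aeval_linearChange (M : Matrix σ σ k) (f : MvPolynomial σ k) {B : Type*} [CommRing B]
    [Algebra k B] (y : σ → B) :
    aeval y (linearChange M f) = aeval (fun i => ∑ j, algebraMap k B (M j i) * y j) f := by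
  rw [linearChange, comp_aeval_apply]
  simp [algHom_C]

theorem linearChange_linearChange [DecidableEq σ] {M M' : Matrix σ σ k} (h : M' * M = 1)
    (f : MvPolynomial σ k) :
    linearChange M' (linearChange M f) = f := by
  conv_rhs => rw [← aeval_X_left_apply f]
  rw [linearChange, linearChange, comp_aeval_apply]
  congr 2
  funext i
  simp only [map_sum, map_mul, algHom_C, aeval_X, algebraMap_eq, Finset.mul_sum]
  rw [Finset.sum_comm]
  have : ∀ l, ∑ j, C (M j i) * (C (M' l j) * X l) = C ((M' * M) l i) * X l := fun l => by
    rw [Matrix.mul_apply, map_sum, Finset.sum_mul]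
    refine Finset.sum_congr rfl fun j _ => ?_
    rw [map_mul]
    ring
  simp_rw [this, h, Matrix.one_apply]
  simp

theorem linearChange_isHomogeneous (M : Matrix σ σ k) {f : MvPolynomial σ k} {t : ℕ}
    (hf : f.IsHomogeneous t) : (linearChange M f).IsHomogeneous t := by
  have := hf.aeval (fun i => ∑ j, C (M j i) * X j) (n := 1) fun i =>
    IsHomogeneous.sum _ _ _ fun j _ => isHomogeneous_C_mul_X _ _
  rwa [one_mul] at this

theorem VanishesToOrder.linearChange {M : Matrix σ σ k} {w : σ → k} {r : ℕ} {f : MvPolynomial σ k}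
    (h : VanishesToOrder (Matrix.vecMul w M) r f) : VanishesToOrder w r (linearChange M f) := by
  intro B _ _ c T Y
  rw [aeval_linearChange]
  refine h.dvd_aeval (c := c) fun i => ⟨∑ j, algebraMap k B (M j i) * Y j, ?_⟩
  simp only [Matrix.vecMul, dotProduct, map_sum, map_mul, Finset.mul_sum]
  rw [← Finset.sum_sub_distrib]
  exact Finset.sum_congr rfl fun j _ => by ring

/-- The Cremona transformation centred at the points of a basis (the rows of `M`). -/
theorem exists_cremona [DecidableEq σ] {M : Matrix σ σ k} (hM : IsUnit M)
    {q : σ → k} (hq : ∀ i, q i ≠ 0)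
    {f : MvPolynomial σ k} {t : ℕ} (hf : f.IsHomogeneous t) (hf0 : f ≠ 0) {d : σ → ℤ}
    (hd : ∀ i, VanishesToOrder (M i) (t - d i).toNat f) :
    ∃ (t' : ℕ) (g : MvPolynomial σ k), g.IsHomogeneous t' ∧ g ≠ 0 ∧ (t' : ℤ) = ∑ i, d i - t ∧
      (∀ i, VanishesToOrder (M i) (t' - d i).toNat g) ∧
      ∀ (w w' : σ → k) (r : ℕ), (∀ i, w i * w' i = q i) →
        VanishesToOrder (Matrix.vecMul w M) r f → VanishesToOrder (Matrix.vecMul w' M) r g := by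
  obtain ⟨M', h1, h2⟩ := isUnit_iff_exists.mp hM
  have hinj {P P' : Matrix σ σ k} (h : P' * P = 1) {f : MvPolynomial σ k} (hf : f ≠ 0) :
      linearChange P f ≠ 0 := fun h0 => hf (by rw [← linearChange_linearChange h f, h0, map_zero])
  obtain ⟨t', g, hg, hg0, ht', hgd, hgw⟩ := exists_cremona_single hq
    (linearChange_isHomogeneous M hf) (hinj h2 hf0) (d := d) fun i => by
      apply VanishesToOrder.linearChange
      rw [Matrix.single_one_vecMul]
      exact hd i
  have hback (w : σ → k) : Matrix.vecMul (Matrix.vecMul w M) M' = w := by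
    rw [Matrix.vecMul_vecMul, h1, Matrix.vecMul_one]
  refine ⟨t', linearChange M' g, linearChange_isHomogeneous _ hg, hinj h1 hg0, ht', fun i => ?_,
    fun w w' r hw h => ?_⟩
  · apply VanishesToOrder.linearChange
    have : M i = Matrix.vecMul (Pi.single i 1) M := by rw [Matrix.single_one_vecMul]; rfl
    rw [this, hback]
    exact hgd i
  · apply VanishesToOrder.linearChange
    rw [hback]
    exact hgw w w' r hw h.linearChange

end LinearChange

/-! ### Cremona symmetries of points in general position -/

section Points

variable {k : Type u} [Field k] {σ : Type} [Fintype σ] {ι : Type*}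

/-- Any `|σ|` members of the family `v` are linearly independent. -/
def GeneralVectors (v : ι → σ → k) : Prop :=
  ∀ e : σ → ι, Function.Injective e → LinearIndependent k (v ∘ e)

theorem GeneralVectors.isUnit [DecidableEq σ] {v : ι → σ → k} (hv : GeneralVectors v) {e : σ → ι}
    (he : Function.Injective e) : IsUnit (Matrix.of fun i => v (e i)) :=
  Matrix.linearIndependent_rows_iff_isUnit.mp (hv e he)

/-- If `w i = 0`, then replacing `e i` by `a` would give a dependent family of `|σ|` members. -/
theorem GeneralVectors.exists_coord [DecidableEq σ] {v : ι → σ → k} (hv : GeneralVectors v)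
    {e : σ → ι} (he : Function.Injective e) {a : ι} (ha : ∀ i, e i ≠ a) :
    ∃ w : σ → k, (∀ i, w i ≠ 0) ∧ Matrix.vecMul w (Matrix.of fun i => v (e i)) = v a := by
  obtain ⟨w, hw⟩ := Matrix.vecMul_surjective_iff_isUnit.mpr (hv.isUnit he) (v a)
  beta_reduce at hw
  refine ⟨w, fun i hi => ?_, hw⟩
  have hinj : Function.Injective (Function.update e i a) := by
    intro x y hxy
    by_cases hx : x = i <;> by_cases hy : y = i
    · rw [hx, hy]
    · subst hx
      rw [Function.update_self, Function.update_of_ne hy] at hxy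
      exact absurd hxy.symm (ha y)
    · subst hy
      rw [Function.update_self, Function.update_of_ne hx] at hxy
      exact absurd hxy (ha x)
    · rw [Function.update_of_ne hx, Function.update_of_ne hy] at hxy
      exact he hxy
  have h := Fintype.linearIndependent_iff.mp (hv _ hinj) (Function.update (-w) i 1) ?_ i
  · simp at h
  · rw [Matrix.vecMul_eq_sum, ← Finset.add_sum_erase _ _ (Finset.mem_univ i), hi, zero_smul,
      zero_add] at hw
    rw [← Finset.add_sum_erase _ _ (Finset.mem_univ i)]
    have : ∀ j ∈ Finset.univ.erase i, Function.update (-w) i 1 j •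
        (v ∘ Function.update e i a) j = -(w j • (Matrix.of fun i => v (e i)) j) := by
      intro j hj
      have hj := Finset.ne_of_mem_erase hj
      simp [Function.update_of_ne hj]
      rfl
    rw [Finset.sum_congr rfl this, Finset.sum_neg_distrib, hw]
    simp

/-- There is a nonzero form of degree `t` vanishing to order at least `t - d i` at each `v i`. -/
def HasForm (v : ι → σ → k) (t : ℕ) (d : ι → ℤ) : Prop :=
  ∃ f : MvPolynomial σ k, f.IsHomogeneous t ∧ f ≠ 0 ∧ ∀ i, VanishesToOrder (v i) (t - d i).toNat f

variable {v : ι → σ → k} {t : ℕ} {d : ι → ℤ}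

/-- Centre the Cremona map at all points but `a`, `b`, and let `q` be the product of their
coordinate vectors: the map swaps `a` and `b`. Hence the new multiplicity at `a` is the old one at
`b`, which in terms of `d` reads `d a ↦ δ - d a` with `δ = ∑ d j - 2 t`. -/
theorem HasForm.flip_pair [Fintype ι] [DecidableEq ι] (hv : GeneralVectors v)
    (hcard : Fintype.card ι = Fintype.card σ + 2) (h : HasForm v t d) {a b : ι} (hab : a ≠ b) :
    ∃ t' : ℕ, (2 * t' : ℤ) = ∑ i, (if i = a ∨ i = b then ∑ j, d j - 2 * t - d i else d i) -
      (∑ j, d j - 2 * t) ∧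
      HasForm v t' fun i => if i = a ∨ i = b then ∑ j, d j - 2 * t - d i else d i := by
  classical
  obtain ⟨f, hf, hf0, hfd⟩ := h
  have hc : Fintype.card σ = Fintype.card (({a, b}ᶜ : Finset ι) : Type _) := by
    rw [Fintype.card_coe, Finset.card_compl, Finset.card_pair hab, hcard, Nat.add_sub_cancel]
  let e := Fintype.equivOfCardEq hc
  have hmem : ∀ i, ((e i : ι) ≠ a) ∧ ((e i : ι) ≠ b) := fun i => by
    have := (e i).2
    rw [Finset.mem_compl, Finset.mem_insert, Finset.mem_singleton, not_or] at this
    exact this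
  have hinj : Function.Injective fun i => (e i : ι) :=
    Subtype.val_injective.comp e.injective
  obtain ⟨wa, hwa0, hwa⟩ := hv.exists_coord hinj fun i => (hmem i).1
  obtain ⟨wb, hwb0, hwb⟩ := hv.exists_coord hinj fun i => (hmem i).2
  obtain ⟨t', g, hg, hg0, ht', hgd, hgw⟩ := exists_cremona (hv.isUnit hinj)
    (q := fun i => wa i * wb i) (fun i => mul_ne_zero (hwa0 i) (hwb0 i)) hf hf0
    (d := fun i => d (e i)) fun i => hfd (e i)
  have hsplit : ∀ F : ι → ℤ, ∑ i, F i = F a + F b + ∑ i, F (e i) := fun F => by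
    rw [← Finset.sum_add_sum_compl {a, b}, Finset.sum_pair hab, e.sum_comp (fun i => F i),
      Finset.sum_coe_sort]
  have hsum : ∑ i, (if ((e i : ι) = a ∨ (e i : ι) = b) then ∑ j, d j - 2 * t - d (e i)
      else d (e i)) = ∑ i, d (e i) :=
    Finset.sum_congr rfl fun i _ => if_neg (by have := hmem i; tauto)
  have hd := hsplit d
  refine ⟨t', ?_, g, hg, hg0, fun i => ?_⟩
  · rw [hsplit, hsum]
    simp only [true_or, or_true, if_true]
    linarith
  · by_cases hia : i = a
    · subst hia
      simp only [true_or, if_true]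
      rw [← hwa]
      convert hgw wb wa _ (fun i => mul_comm _ _) (by rw [hwb]; exact hfd b) using 1
      congr 1
      linarith
    by_cases hib : i = b
    · subst hib
      simp only [or_true, if_true]
      rw [← hwb]
      convert hgw wa wb _ (fun i => rfl) (by rw [hwa]; exact hfd a) using 1
      congr 1
      linarith
    · have hi : i ∈ ({a, b}ᶜ : Finset ι) := by simp [hia, hib]
      have := hgd (e.symm ⟨i, hi⟩)
      change VanishesToOrder (v (e (e.symm ⟨i, hi⟩))) _ g at this
      rw [Equiv.apply_symm_apply] at this
      simpa [hia, hib] using this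

theorem HasForm.flip [Fintype ι] [DecidableEq ι] (hv : GeneralVectors v)
    (hcard : Fintype.card ι = Fintype.card σ + 2) (h : HasForm v t d) {S : Finset ι}
    (hS : Even S.card) :
    ∃ t' : ℕ, (2 * t' : ℤ) = ∑ i, (if i ∈ S then ∑ j, d j - 2 * t - d i else d i) -
      (∑ j, d j - 2 * t) ∧
      HasForm v t' fun i => if i ∈ S then ∑ j, d j - 2 * t - d i else d i := by
  obtain ⟨r, hr⟩ := hS
  induction r generalizing S with
  | zero =>
    obtain rfl : S = ∅ := Finset.card_eq_zero.mp (by omega)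
    exact ⟨t, by simp, by simpa using h⟩
  | succ r ih =>
    obtain ⟨a, ha⟩ := Finset.card_pos.mp (show 0 < S.card by omega)
    have h1 := Finset.card_erase_of_mem ha
    obtain ⟨b, hb⟩ := Finset.card_pos.mp (show 0 < (S.erase a).card by omega)
    have h2 := Finset.card_erase_of_mem hb
    obtain ⟨t₁, ht₁, hform⟩ := ih (S := (S.erase a).erase b) (by omega)
    have hba := Finset.ne_of_mem_erase hb
    have hbS := Finset.mem_of_mem_erase hb
    -- Flips preserve `δ`, so the next pair is flipped with the same constant.
    have hD : ∑ i, (if i ∈ (S.erase a).erase b then ∑ j, d j - 2 * t - d i else d i) - 2 * t₁ =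
      ∑ j, d j - 2 * t := by linarith
    have h3 := hform.flip_pair hv hcard hba.symm
    rw [hD] at h3
    have hfun : ∀ i, (if i = a ∨ i = b then ∑ j, d j - 2 * t -
        (if i ∈ (S.erase a).erase b then ∑ j, d j - 2 * t - d i else d i) else
        (if i ∈ (S.erase a).erase b then ∑ j, d j - 2 * t - d i else d i)) =
        if i ∈ S then ∑ j, d j - 2 * t - d i else d i := by
      intro i
      by_cases hia : i = a
      · subst hia
        simp [ha]
      by_cases hib : i = b
      · subst hib
        simp [hbS]
      simp [hia, hib]
    simp_rw [hfun] at h3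
    exact h3

/-- Degree bound for forms vanishing at the points of a basis. -/
theorem mul_le_of_vanishes_basis [DecidableEq σ] (hv : GeneralVectors v) {e : σ → ι}
    (he : Function.Injective e) {f : MvPolynomial σ k} (hf : f.IsHomogeneous t) (hf0 : f ≠ 0)
    {m : ℕ} (h : ∀ i, VanishesToOrder (v i) m f) :
    (Fintype.card σ : ℤ) * m ≤ (Fintype.card σ - 1) * t := by
  obtain ⟨t', g, hg, hg0, ht', -⟩ := exists_cremona (hv.isUnit he)
    (q := fun _ => 1) (fun i => one_ne_zero) hf hf0
    (d := fun i => (t : ℤ) - m) fun i => by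
      change VanishesToOrder (v (e i)) _ f
      simpa using h (e i)
  -- The bound is `0 ≤ t'`.
  simp at ht'
  linarith

/-- Degree bound for forms vanishing at the points of a basis and a further point. -/
theorem mul_le_of_vanishes_basis_add_one [DecidableEq σ] (hv : GeneralVectors v) {e : σ → ι}
    (he : Function.Injective e) {a : ι} (ha : ∀ i, e i ≠ a) {f : MvPolynomial σ k}
    (hf : f.IsHomogeneous t) (hf0 : f ≠ 0) {m : ℕ} (h : ∀ i, VanishesToOrder (v i) m f) :
    (Fintype.card σ + 1 : ℤ) * m ≤ (Fintype.card σ - 1) * t := by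
  obtain ⟨w, hw0, hw⟩ := hv.exists_coord he ha
  obtain ⟨t', g, hg, hg0, ht', -, hgw⟩ := exists_cremona (hv.isUnit he)
    -- This `q` makes the map fix the further point, so the multiplicity there is still `m` and is
    -- at most `t'`.
    (q := fun i => w i * w i) (fun i => mul_ne_zero (hw0 i) (hw0 i)) hf hf0
    (d := fun i => (t : ℤ) - m) fun i => by
      change VanishesToOrder (v (e i)) _ f
      simpa using h (e i)
  have hm := (hgw w w m (fun _ => rfl) (by rw [hw]; exact h a)).le_degree hg hg0
  simp at ht'
  zify at hm
  linarith

/-- Degree bound for forms vanishing at `|σ| + 2` points, when `|σ|` is even. -/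
theorem mul_le_of_vanishes_of_even [Fintype ι] (hv : GeneralVectors v)
    (hcard : Fintype.card ι = Fintype.card σ + 2) (heven : Even (Fintype.card ι))
    {f : MvPolynomial σ k} (hf : f.IsHomogeneous t) (hf0 : f ≠ 0) {m : ℕ}
    (h : ∀ i, VanishesToOrder (v i) m f) :
    (Fintype.card ι : ℤ) * (t - m) ≤
      (Fintype.card ι - 1) * (Fintype.card ι * (t - m) - 2 * t) := by
  classical
  have hform : HasForm v t fun _ => (t : ℤ) - m := ⟨f, hf, hf0, fun i => by simpa using h i⟩
  -- Flip every point; the bound is again `0 ≤ t'`.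
  obtain ⟨t', ht', -⟩ := hform.flip hv hcard (S := Finset.univ) (by simpa using heven)
  simp at ht'
  linarith

/-- A form of high multiplicity at the points of a basis. -/
theorem exists_form_basis [DecidableEq σ] (hv : GeneralVectors v) {e : σ → ι}
    (he : Function.Injective e) :
    ∃ f : MvPolynomial σ k, f.IsHomogeneous (Fintype.card σ) ∧ f ≠ 0 ∧
      ∀ i, VanishesToOrder (v (e i)) (Fintype.card σ - 1) f := by
  -- The constant `1` has `t = 0`; with `d = 1` the required order `(0 - 1).toNat` is `0`.
  obtain ⟨t', g, hg, hg0, ht', hgd, -⟩ := exists_cremona (hv.isUnit he)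
    (q := fun _ => 1) (fun i => one_ne_zero) (isHomogeneous_one σ k) one_ne_zero
    (d := fun i => 1) fun i => VanishesToOrder.zero _
  simp at ht'
  subst ht'
  refine ⟨g, hg, hg0, fun i => (hgd i).mono (by omega)⟩

/-- A form of high multiplicity at `|σ| + 2` points, when `|σ|` is even. -/
theorem exists_form_of_even [Fintype ι] (hv : GeneralVectors v)
    (hcard : Fintype.card ι = Fintype.card σ + 2) (heven : Even (Fintype.card ι)) :
    ∃ (t' : ℕ) (f : MvPolynomial σ k), f.IsHomogeneous t' ∧ f ≠ 0 ∧
      (2 * t' : ℤ) = Fintype.card ι * (Fintype.card ι - 1) - Fintype.card ι ∧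
      ∀ i, VanishesToOrder (v i) (t' - (Fintype.card ι - 1) : ℤ).toNat f := by
  classical
  have hform : HasForm v 0 fun _ => 1 := ⟨1, isHomogeneous_one σ k, one_ne_zero,
    fun i => VanishesToOrder.zero _⟩
  obtain ⟨t', ht', f, hf, hf0, h⟩ := hform.flip hv hcard (S := Finset.univ) (by simpa using heven)
  simp at ht' h
  exact ⟨t', f, hf, hf0, by linarith, h⟩

/-- A form of high multiplicity at `|σ| + 2` points, when `|σ|` is odd. -/
theorem exists_form_of_odd [Fintype ι] (hv : GeneralVectors v)
    (hcard : Fintype.card ι = Fintype.card σ + 2) (hodd : Odd (Fintype.card ι)) :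
    ∃ (t' : ℕ) (f : MvPolynomial σ k), f.IsHomogeneous t' ∧ f ≠ 0 ∧
      (2 * t' : ℤ) = Fintype.card ι - 1 ∧ ∀ i, VanishesToOrder (v i) (t' - 1) f := by
  classical
  obtain ⟨a⟩ : Nonempty ι := Fintype.card_pos_iff.mp (by omega)
  -- Here `δ = 1`, so flipping every point but `a` turns all the `d i` into `1`.
  have hform : HasForm v 0 fun i => if i = a then 1 else 0 := ⟨1, isHomogeneous_one σ k,
    one_ne_zero, fun i => by
      convert VanishesToOrder.zero _ using 1
      beta_reduce
      split_ifs <;> simp⟩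
  obtain ⟨t', ht', f, hf, hf0, h⟩ := hform.flip hv hcard (S := Finset.univ.erase a) (by
    rw [Finset.card_erase_of_mem (Finset.mem_univ a), Finset.card_univ]
    exact Nat.Odd.sub_odd hodd odd_one)
  have hd : ∀ i, (if i ∈ Finset.univ.erase a then ∑ j, (if j = a then (1 : ℤ) else 0) -
      2 * (0 : ℕ) - (if i = a then 1 else 0) else (if i = a then 1 else 0)) = 1 := by
    intro i
    by_cases hi : i = a <;> simp [hi]
  simp_rw [hd] at ht' h
  refine ⟨t', f, hf, hf0, ?_, fun i => (h i).mono (by omega)⟩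
  simpa using ht'

end Points

/-! ### Symbolic powers of an intersection of incomparable primes -/

section Prime

variable {R : Type*} [CommRing R] {ι : Type*} [Fintype ι] {I : ι → Ideal R}

theorem mem_associatedPrimes_quotient_iff [IsNoetherianRing R] {J P : Ideal R} :
    P ∈ associatedPrimes R (R ⧸ J) ↔ P.IsPrime ∧ ∃ g : R, ∀ r, r ∈ P ↔ r * g ∈ J := by
  rw [AssociatedPrimes.mem_iff, isAssociatedPrime_iff]
  refine and_congr_right fun _ => ?_
  have key : ∀ g : R, P = Submodule.colon (⊥ : Submodule R (R ⧸ J)) {Ideal.Quotient.mk J g} ↔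
      ∀ r, r ∈ P ↔ r * g ∈ J := by
    intro g
    rw [SetLike.ext_iff]
    refine forall_congr' fun r => ?_
    rw [Submodule.mem_colon_singleton, Submodule.mem_bot, ← Ideal.Quotient.eq_zero_iff_mem (I := J),
      map_mul]
    rfl
  constructor
  · rintro ⟨x, hx⟩
    obtain ⟨g, rfl⟩ := Ideal.Quotient.mk_surjective x
    exact ⟨g, (key g).mp hx⟩
  · rintro ⟨g, hg⟩
    exact ⟨_, (key g).mpr hg⟩

theorem exists_mem_of_ne_notMem (hI : ∀ i, (I i).IsPrime) (hne : ∀ i j, i ≠ j → ¬ I j ≤ I i)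
    (i : ι) : ∃ h, (∀ j, j ≠ i → h ∈ I j) ∧ h ∉ I i := by
  classical
  have h1 : ¬ (Finset.univ.erase i).inf I ≤ I i := by
    rw [(hI i).inf_le']
    rintro ⟨j, hj, hle⟩
    exact hne i j (Finset.ne_of_mem_erase hj).symm hle
  obtain ⟨h, hmem, hnot⟩ := SetLike.not_le_iff_exists.mp h1
  refine ⟨h, fun j hj => ?_, hnot⟩
  exact (Submodule.mem_finsetInf.mp hmem) j (by simp [hj])

theorem associatedPrimes_quotient_iInf [IsNoetherianRing R] (hI : ∀ i, (I i).IsPrime)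
    (hne : ∀ i j, i ≠ j → ¬ I j ≤ I i) :
    associatedPrimes R (R ⧸ ⨅ i, I i) = Set.range I := by
  classical
  ext P
  rw [mem_associatedPrimes_quotient_iff]
  constructor
  · rintro ⟨hP, g, hg⟩
    -- The primes not containing `g` have intersection annihilating `g` modulo `⨅ i, I i`; one of
    -- them therefore lies in `P`.
    have hle : (Finset.univ.filter fun i => g ∉ I i).inf I ≤ P := by
      intro r hr
      rw [hg, Ideal.mem_iInf]
      intro i
      by_cases hi : g ∈ I i
      · exact (I i).mul_mem_left _ hi
      · exact (I i).mul_mem_right _ (Submodule.mem_finsetInf.mp hr i (by simp [hi]))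
    obtain ⟨i, hi, hiP⟩ := hP.inf_le'.mp hle
    refine ⟨i, le_antisymm hiP fun r hr => ?_⟩
    have := (Ideal.mem_iInf.mp ((hg r).mp hr)) i
    exact ((hI i).mem_or_mem this).resolve_right (Finset.mem_filter.mp hi).2
  · rintro ⟨i, rfl⟩
    obtain ⟨h, hmem, hnot⟩ := exists_mem_of_ne_notMem hI hne i
    refine ⟨hI i, h, fun r => ⟨fun hr => ?_, fun hr => ?_⟩⟩
    · rw [Ideal.mem_iInf]
      intro j
      by_cases hj : j = i
      · subst hj
        exact (I j).mul_mem_right _ hr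
      · exact (I j).mul_mem_left _ (hmem j hj)
    · exact ((hI i).mem_or_mem (Ideal.mem_iInf.mp hr i)).resolve_right hnot

theorem mem_symbolicPower_iff [IsNoetherianRing R] (hI : ∀ i, (I i).IsPrime)
    (hne : ∀ i j, i ≠ j → ¬ I j ≤ I i) {m : ℕ} {f : R} :
    f ∈ symbolicPower (⨅ i, I i) m ↔ ∀ i, ∃ u ∉ I i, u * f ∈ (⨅ i, I i) ^ m := by
  have hass := associatedPrimes_quotient_iInf hI hne
  simp only [symbolicPower, Ideal.mem_iInf, Ideal.mem_comap]
  constructor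
  · intro h i
    have hi : I i ∈ associatedPrimes R (R ⧸ ⨅ i, I i) := hass ▸ ⟨i, rfl⟩
    have := hI i
    exact (IsLocalization.algebraMap_mem_map_algebraMap_iff (I i).primeCompl
      (Localization.AtPrime (I i)) _ _).mp (h _ hi)
  · intro h P hP
    obtain ⟨i, rfl⟩ : P ∈ Set.range I := hass ▸ hP
    have := hI i
    exact (IsLocalization.algebraMap_mem_map_algebraMap_iff (I i).primeCompl
      (Localization.AtPrime (I i)) _ _).mpr (h i)

/-- Take `h` in all the other primes but not in `I i`. Then `h * I i` lies in the intersection, so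
`h ^ m` is the required denominator at `I i`. -/
theorem mem_symbolicPower_of_mem_pow [IsNoetherianRing R] (hI : ∀ i, (I i).IsPrime)
    (hne : ∀ i j, i ≠ j → ¬ I j ≤ I i) {m : ℕ} {f : R} (hf : ∀ i, f ∈ I i ^ m) :
    f ∈ symbolicPower (⨅ i, I i) m := by
  rw [mem_symbolicPower_iff hI hne]
  intro i
  obtain ⟨h, hmem, hnot⟩ := exists_mem_of_ne_notMem hI hne i
  refine ⟨h ^ m, fun hm => hnot ((hI i).mem_of_pow_mem m hm), ?_⟩
  have hle : Ideal.span {h} * I i ≤ ⨅ i, I i := by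
    rw [Ideal.span_singleton_mul_le_iff]
    intro r hr
    rw [Ideal.mem_iInf]
    intro j
    by_cases hj : j = i
    · subst hj
      exact (I j).mul_mem_left _ hr
    · exact (I j).mul_mem_right _ (hmem j hj)
  have := Ideal.pow_right_mono hle m
  rw [mul_pow] at this
  exact this (Ideal.mul_mem_mul (Ideal.pow_mem_pow (Ideal.mem_span_singleton_self h) m) (hf i))

end Prime

/-! ### The prime of a point, and its powers as orders of vanishing -/

section LineIdeal

variable {k : Type u} [Field k] {σ : Type}

/-- The ideal of all polynomials vanishing on the generic point of the line spanned by `v`. -/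
noncomputable def lineIdeal (v : σ → k) : Ideal (MvPolynomial σ k) :=
  RingHom.ker (aeval (R := k) fun i => (Polynomial.X * Polynomial.C (v i) : Polynomial k))

theorem mem_lineIdeal {v : σ → k} {f : MvPolynomial σ k} :
    f ∈ lineIdeal v ↔ aeval (fun i => (Polynomial.X * Polynomial.C (v i) : Polynomial k)) f = 0 :=
  RingHom.mem_ker

theorem lineIdeal_isPrime (v : σ → k) : (lineIdeal v).IsPrime := RingHom.ker_isPrime _

theorem aeval_line_of_isHomogeneous (v : σ → k) {f : MvPolynomial σ k} {t : ℕ}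
    (hf : f.IsHomogeneous t) :
    aeval (fun i => (Polynomial.X * Polynomial.C (v i) : Polynomial k)) f =
      Polynomial.C (eval v f) * Polynomial.X ^ t := by
  rw [aeval_homogeneous_mul hf, mul_comm]
  congr 1
  have := comp_aeval_apply (R := k) v (Algebra.ofId k (Polynomial k)) f
  simpa [Algebra.ofId_apply] using this.symm

theorem mem_lineIdeal_of_isHomogeneous {v : σ → k} {f : MvPolynomial σ k} {t : ℕ}
    (hf : f.IsHomogeneous t) : f ∈ lineIdeal v ↔ eval v f = 0 := by
  rw [mem_lineIdeal, aeval_line_of_isHomogeneous v hf]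
  simp

theorem eval_homogeneousComponent_of_mem_lineIdeal {v : σ → k} {f : MvPolynomial σ k}
    (hf : f ∈ lineIdeal v) (t : ℕ) : eval v (homogeneousComponent t f) = 0 := by
  by_cases ht : f.totalDegree < t
  · rw [homogeneousComponent_eq_zero _ _ ht, map_zero]
  rw [mem_lineIdeal, ← sum_homogeneousComponent f, map_sum,
    Finset.sum_congr rfl fun i _ => aeval_line_of_isHomogeneous v
      (homogeneousComponent_isHomogeneous i f)] at hf
  have := congrArg (fun p => Polynomial.coeff p t) hf
  simp only [Polynomial.finsetSum_coeff, Polynomial.coeff_C_mul_X_pow, Polynomial.coeff_zero,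
    Finset.sum_ite_eq, Finset.mem_range] at this
  rwa [if_pos (by omega)] at this

theorem VanishesToOrder.of_mem_lineIdeal {v : σ → k} {f : MvPolynomial σ k}
    (hf : f ∈ lineIdeal v) : VanishesToOrder v 1 f := by
  intro B _ _ c T Y
  rw [pow_one, ← Ideal.mem_span_singleton, ← Ideal.Quotient.eq_zero_iff_mem,
    ← Ideal.Quotient.mkₐ_eq_mk k, comp_aeval_apply]
  have h := congrArg (Polynomial.aeval (R := k) (Ideal.Quotient.mkₐ k (Ideal.span {T}) c))
    (mem_lineIdeal.mp hf)
  rw [comp_aeval_apply, map_zero] at h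
  rw [← h]
  congr 2
  funext i
  have hT : Ideal.Quotient.mk (Ideal.span {T}) T = 0 :=
    Ideal.Quotient.eq_zero_iff_mem.mpr (Ideal.mem_span_singleton_self T)
  simp only [map_add, map_mul, Polynomial.aeval_X, Polynomial.aeval_C, AlgHom.commutes]
  simp [hT]

theorem VanishesToOrder.of_mem_lineIdeal_pow {v : σ → k} {f : MvPolynomial σ k} {m : ℕ}
    (hf : f ∈ lineIdeal v ^ m) : VanishesToOrder v m f := by
  intro B _ _ c T Y
  have hle : lineIdeal v ≤ (Ideal.span {T}).comap
      (aeval (R := k) fun i => c * algebraMap k B (v i) + T * Y i) := fun g hg => by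
    rw [Ideal.mem_comap, Ideal.mem_span_singleton]
    simpa using of_mem_lineIdeal hg B c T Y
  rw [← Ideal.mem_span_singleton, ← Ideal.span_singleton_pow]
  exact Ideal.le_comap_pow _ m (Ideal.pow_right_mono hle m hf)

theorem X_none_not_dvd_aeval_genericPoint {v : σ → k} {f : MvPolynomial σ k}
    (hf : f ∉ lineIdeal v) : ¬ X none ∣ aeval (genericPoint v) f := by
  intro h
  apply hf
  rw [mem_lineIdeal]
  have h2 := map_dvd (aeval (R := k) (fun o : Option (Option σ) =>
    o.elim (0 : Polynomial k) fun o' => o'.elim Polynomial.X 0)) h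
  rw [comp_aeval_apply] at h2
  simpa [genericPoint, Polynomial.algebraMap_eq] using h2

theorem VanishesToOrder.of_mul {v : σ → k} {f u : MvPolynomial σ k} {m : ℕ}
    (h : VanishesToOrder v m (u * f)) (hu : u ∉ lineIdeal v) : VanishesToOrder v m f := by
  rw [vanishesToOrder_iff_generic] at h ⊢
  rw [map_mul] at h
  exact X_prime.pow_dvd_of_dvd_mul_left m (X_none_not_dvd_aeval_genericPoint hu) h

/-- Choose `v l ≠ 0` and evaluate `f` at `X l * v + T * Y` with `Y i = v l * X i - v i * X l` in the
ideal `I`. The coefficient of `T ^ j` lies in `I ^ j` (Rees algebra), and those with `j < m` vanish.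
At `T = 1` the point is `v l * X`, so `v l ^ t * f` lies in `I ^ m`. -/
theorem VanishesToOrder.mem_lineIdeal_pow {v : σ → k} (hv : v ≠ 0) {f : MvPolynomial σ k} {t m : ℕ}
    (hf : f.IsHomogeneous t) (h : VanishesToOrder v m f) : f ∈ lineIdeal v ^ m := by
  obtain ⟨l, hl⟩ := Function.ne_iff.mp hv
  set I := lineIdeal v
  have hY : ∀ i, C (v l) * X i - C (v i) * X l ∈ I := fun i => by
    rw [mem_lineIdeal_of_isHomogeneous (t := 1)
      ((isHomogeneous_C_mul_X _ _).sub (isHomogeneous_C_mul_X _ _))]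
    simp [mul_comm]
  let x : σ → Polynomial (MvPolynomial σ k) := fun i =>
    Polynomial.C (X l) * algebraMap k _ (v i) +
      Polynomial.X * Polynomial.C (C (v l) * X i - C (v i) * X l)
  have hx : ∀ i, x i ∈ (reesAlgebra I).restrictScalars k := fun i => by
    refine add_mem ?_ ?_
    · exact mul_mem (Subalgebra.algebraMap_mem (reesAlgebra I) (X l)) (Subalgebra.algebraMap_mem _ _)
    · rw [Polynomial.X_mul_C, ← pow_one (Polynomial.X : Polynomial (MvPolynomial σ k)),
        Polynomial.C_mul_X_pow_eq_monomial]
      exact reesAlgebra.monomial_mem.mpr (by rw [pow_one]; exact hY i)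
  have hrees : aeval x f ∈ (reesAlgebra I).restrictScalars k := by
    have := comp_aeval_apply (R := k) (fun i => (⟨x i, hx i⟩ : (reesAlgebra I).restrictScalars k))
      ((reesAlgebra I).restrictScalars k).val f
    exact this ▸ Subtype.property _
  have hdvd : Polynomial.X ^ m ∣ aeval x f := h _ _ _ _
  rw [Polynomial.X_pow_dvd_iff] at hdvd
  have hmem : (aeval x f).eval 1 ∈ I ^ m := by
    rw [Polynomial.eval_eq_sum_range]
    refine Ideal.sum_mem _ fun j _ => ?_
    rw [one_pow, mul_one]
    by_cases hj : j < m
    · rw [hdvd j hj]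
      exact zero_mem _
    · exact Ideal.pow_le_pow_right (not_lt.mp hj) (hrees j)
  have heval : (aeval x f).eval 1 = C (v l) ^ t * f := by
    have h1 := comp_aeval_apply (R := k) x
      ((Polynomial.aeval (1 : MvPolynomial σ k)).restrictScalars k) f
    have h2 : (fun i => ((Polynomial.aeval (1 : MvPolynomial σ k)).restrictScalars k) (x i)) =
        fun i => C (v l) * X i := by
      funext i
      simp [x, Polynomial.algebraMap_apply, Polynomial.coe_aeval_eq_eval]
      ring
    rw [h2, aeval_homogeneous_mul hf, aeval_X_left_apply] at h1
    simpa [Polynomial.coe_aeval_eq_eval] using h1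
  rw [heval] at hmem
  have : f = C ((v l)⁻¹ ^ t) * (C (v l) ^ t * f) := by
    rw [← mul_assoc, ← map_pow, ← map_mul, ← mul_pow, inv_mul_cancel₀ hl]
    simp
  rw [this]
  exact Ideal.mul_mem_left _ _ hmem

/-- The linear form with given values. -/
theorem exists_linear_form [Fintype σ] (φ : Module.Dual k (σ → k)) :
    ∃ L : MvPolynomial σ k, L.IsHomogeneous 1 ∧ ∀ w, eval w L = φ w := by
  classical
  refine ⟨∑ i, C (φ (Pi.single i 1)) * X i,
    IsHomogeneous.sum _ _ _ fun i _ => isHomogeneous_C_mul_X _ _, fun w => ?_⟩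
  conv_rhs => rw [pi_eq_sum_univ' w]
  simp [mul_comm]

theorem exists_hyperplane [Fintype σ] {ι : Type*} (v : ι → σ → k) (S : Finset ι)
    (hS : S.card < Fintype.card σ) :
    ∃ L : MvPolynomial σ k, L.IsHomogeneous 1 ∧ L ≠ 0 ∧ ∀ i ∈ S, VanishesToOrder (v i) 1 L := by
  classical
  have hlt : Submodule.span k (S.image v : Set (σ → k)) < ⊤ := by
    rw [lt_top_iff_ne_top]
    intro htop
    have h1 := finrank_span_finset_le_card (R := k) (S.image v)
    rw [Set.finrank, htop, finrank_top, Module.finrank_fintype_fun_eq_card] at h1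
    have := Finset.card_image_le (s := S) (f := v)
    omega
  obtain ⟨φ, hφ0, hφ⟩ := Submodule.exists_le_ker_of_lt_top _ hlt
  obtain ⟨L, hL, hLw⟩ := exists_linear_form φ
  refine ⟨L, hL, ?_, fun i hi => VanishesToOrder.of_mem_lineIdeal ?_⟩
  · rintro rfl
    exact hφ0 (LinearMap.ext fun w => by rw [← hLw]; simp)
  · rw [mem_lineIdeal_of_isHomogeneous hL, hLw]
    exact hφ (Submodule.subset_span (by simpa using ⟨i, hi, rfl⟩))

theorem not_lineIdeal_le [Fintype σ] {v w : σ → k} (h : v ∉ Submodule.span k {w}) :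
    ¬ lineIdeal w ≤ lineIdeal v := by
  obtain ⟨φ, hφ0, hφ⟩ := Submodule.exists_le_ker_of_notMem h
  obtain ⟨L, hL, hLw⟩ := exists_linear_form φ
  intro hle
  have := hle (show L ∈ lineIdeal w by
    rw [mem_lineIdeal_of_isHomogeneous hL, hLw]
    exact hφ (Submodule.mem_span_singleton_self w))
  rw [mem_lineIdeal_of_isHomogeneous hL, hLw] at this
  exact hφ0 this

end LineIdeal

/-! ### Symbolic powers of the ideal of points, and the five cases -/

section PointsIdeal

variable {k : Type u} [Field k] {n s : ℕ} {p : Fin s → ℙ k (Fin (n + 1) → k)}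

theorem InGeneralPosition.linearIndependent (hp : InGeneralPosition p) {κ : Type*} [Fintype κ]
    {e : κ → Fin s} (he : Function.Injective e) (hκ : Fintype.card κ ≤ n + 1) :
    LinearIndependent k fun i => (p (e i)).rep := by
  have h := hp (Finset.univ.image e) (by rwa [Finset.card_image_of_injective _ he])
  rw [Projectivization.independent_iff] at h
  exact h.comp (fun i : κ => (⟨e i, Finset.mem_image_of_mem e (Finset.mem_univ i)⟩ :
    {x // x ∈ Finset.univ.image e})) fun i j hij => he (congrArg Subtype.val hij)

theorem InGeneralPosition.generalVectors (hp : InGeneralPosition p) :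
    GeneralVectors fun i => (p i).rep :=
  fun _ he => hp.linearIndependent he (by simp)

theorem InGeneralPosition.not_lineIdeal_le (hp : InGeneralPosition p) (hn : 1 ≤ n) (i j : Fin s)
    (hij : i ≠ j) : ¬ lineIdeal (p j).rep ≤ lineIdeal (p i).rep := by
  apply Waldschmidt.not_lineIdeal_le
  have h := hp.linearIndependent (e := ![i, j]) (by
    intro x y hxy
    fin_cases x <;> fin_cases y <;> simp_all) (by simpa using hn)
  rw [linearIndependent_fin2] at h
  intro hmem
  obtain ⟨a, ha⟩ := Submodule.mem_span_singleton.mp hmem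
  exact h.2 a ha

theorem pointsIdeal_range (p : Fin s → ℙ k (Fin (n + 1) → k)) :
    pointsIdeal (Set.range p) = ⨅ i, lineIdeal (p i).rep := by
  apply le_antisymm
  · refine Ideal.span_le.mpr ?_
    rintro f ⟨⟨d, hd⟩, hf⟩
    rw [SetLike.mem_coe, Ideal.mem_iInf]
    intro i
    rw [mem_lineIdeal_of_isHomogeneous hd]
    refine hf _ ⟨i, rfl⟩ _ ?_
    rw [Projectivization.submodule_eq]
    exact Submodule.mem_span_singleton_self _
  · intro f hf
    rw [← sum_homogeneousComponent f]
    refine Ideal.sum_mem _ fun d _ => Ideal.subset_span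
      ⟨⟨d, homogeneousComponent_isHomogeneous d f⟩, ?_⟩
    rintro _ ⟨i, rfl⟩ v hv
    rw [Projectivization.submodule_eq, Submodule.mem_span_singleton] at hv
    obtain ⟨c, rfl⟩ := hv
    have h := aeval_homogeneous_mul (homogeneousComponent_isHomogeneous d f) c (p i).rep
    change eval (c • (p i).rep) _ = _ * eval (p i).rep _ at h
    rw [h, eval_homogeneousComponent_of_mem_lineIdeal (Ideal.mem_iInf.mp hf i), mul_zero]

theorem mem_symbolicPower_pointsIdeal_iff (hp : InGeneralPosition p) (hn : 1 ≤ n)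
    {f : MvPolynomial (Fin (n + 1)) k} {t m : ℕ} (hf : f.IsHomogeneous t) :
    f ∈ symbolicPower (pointsIdeal (Set.range p)) m ↔
      ∀ i, VanishesToOrder (p i).rep m f := by
  have hI : ∀ i, (lineIdeal (p i).rep).IsPrime := fun i => lineIdeal_isPrime _
  rw [pointsIdeal_range]
  constructor
  · intro h i
    obtain ⟨u, hu, huf⟩ := (mem_symbolicPower_iff hI (hp.not_lineIdeal_le hn)).mp h i
    exact (VanishesToOrder.of_mem_lineIdeal_pow
      (Ideal.pow_right_mono (iInf_le _ i) m huf)).of_mul hu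
  · intro h
    exact mem_symbolicPower_of_mem_pow hI (hp.not_lineIdeal_le hn) fun i =>
      (h i).mem_lineIdeal_pow (p i).rep_nonzero hf

/-- Rounding `m` up to a multiple of `m₀` squeezes `a m / m` between `c` and `c + t₀ / m`; the
infimum is attained at `m₀`. -/
theorem tendsto_and_isGLB_of_bounds {a : ℕ → ℕ} {c : ℝ} (hlow : ∀ m, c * m ≤ a m) {t₀ m₀ : ℕ}
    (hm₀ : 1 ≤ m₀) (ht₀ : (t₀ : ℝ) ≤ c * m₀) (hup : ∀ j m, m ≤ m₀ * j → a m ≤ t₀ * j) :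
    Tendsto (fun m : ℕ => (a m : ℝ) / m) atTop (𝓝 c) ∧
      IsGLB {x : ℝ | ∃ m : ℕ, 1 ≤ m ∧ x = (a m : ℝ) / m} c := by
  have hm₀' : (0 : ℝ) < m₀ := by exact_mod_cast hm₀
  have hlow' : ∀ m : ℕ, 1 ≤ m → c ≤ (a m : ℝ) / m := fun m hm => by
    rw [le_div_iff₀ (by exact_mod_cast hm)]
    exact hlow m
  constructor
  · have hlim : Tendsto (fun m : ℕ => c + (t₀ : ℝ) / m) atTop (𝓝 c) := by
      simpa using (tendsto_const_nhds (x := c)).add (tendsto_const_div_atTop_nhds_zero_nat (t₀ : ℝ))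
    refine tendsto_of_tendsto_of_tendsto_of_le_of_le' tendsto_const_nhds hlim ?_ ?_
    · filter_upwards [eventually_ge_atTop 1] with m hm using hlow' m hm
    · filter_upwards [eventually_ge_atTop 1] with m hm
      have hm' : (0 : ℝ) < m := by exact_mod_cast hm
      have h1 : (a m : ℝ) ≤ t₀ * ((m / m₀ : ℕ) + 1 : ℝ) := by
        exact_mod_cast hup (m / m₀ + 1) m (Nat.lt_mul_div_succ m hm₀).le
      have h2 : ((m₀ * (m / m₀) : ℕ) : ℝ) ≤ m := by exact_mod_cast Nat.mul_div_le m m₀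
      push_cast at h2
      have hc : 0 ≤ c := by
        by_contra hc
        have : (0 : ℝ) ≤ t₀ := Nat.cast_nonneg _
        nlinarith
      have h3 : (t₀ : ℝ) * (m / m₀ : ℕ) ≤ c * m :=
        calc (t₀ : ℝ) * (m / m₀ : ℕ) ≤ c * m₀ * (m / m₀ : ℕ) :=
              mul_le_mul_of_nonneg_right ht₀ (Nat.cast_nonneg _)
          _ = c * (m₀ * (m / m₀ : ℕ)) := by ring
          _ ≤ c * m := mul_le_mul_of_nonneg_left h2 hc
      rw [div_le_iff₀ hm', add_mul, div_mul_cancel₀ _ hm'.ne']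
      linarith
  · refine ⟨?_, fun b hb => ?_⟩
    · rintro x ⟨m, hm, rfl⟩
      exact hlow' m hm
    · refine (hb ⟨m₀, hm₀, rfl⟩).trans ?_
      rw [div_le_iff₀ hm₀']
      have : (a m₀ : ℝ) ≤ t₀ := by exact_mod_cast (by simpa using hup 1 m₀ (by simp))
      exact this.trans ht₀

theorem isWaldschmidtConstant_of_bounds (hp : InGeneralPosition p) (hn : 1 ≤ n) {c : ℝ}
    (hlow : ∀ (m t : ℕ) (f : MvPolynomial (Fin (n + 1)) k), f.IsHomogeneous t → f ≠ 0 →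
      (∀ i, VanishesToOrder (p i).rep m f) → c * m ≤ t)
    {t₀ m₀ : ℕ} {F : MvPolynomial (Fin (n + 1)) k} (hF : F.IsHomogeneous t₀) (hF0 : F ≠ 0)
    (hFv : ∀ i, VanishesToOrder (p i).rep m₀ F) (hm₀ : 1 ≤ m₀) (ht₀ : (t₀ : ℝ) ≤ c * m₀) :
    IsWaldschmidtConstant (pointsIdeal (Set.range p)) c := by
  have hmem : ∀ j m, m ≤ m₀ * j → t₀ * j ∈ {t : ℕ |
      ∃ f ∈ symbolicPower (pointsIdeal (Set.range p)) m,
      f ≠ 0 ∧ f.IsHomogeneous t} := fun j m hm =>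
    ⟨F ^ j, (mem_symbolicPower_pointsIdeal_iff hp hn (hF.pow j)).mpr fun i =>
      ((hFv i).pow j).mono hm, pow_ne_zero _ hF0, hF.pow j⟩
  obtain ⟨h1, h2⟩ := tendsto_and_isGLB_of_bounds
    (a := fun m => initialDegree (symbolicPower (pointsIdeal (Set.range p)) m)) (c := c)
    (fun m => by
      obtain ⟨f, hf, hf0, hft⟩ := Nat.sInf_mem ⟨_, hmem m m (Nat.le_mul_of_pos_left m hm₀)⟩
      exact hlow m _ f hft hf0 ((mem_symbolicPower_pointsIdeal_iff hp hn hft).mp hf))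
    hm₀ ht₀ fun j m hm => Nat.sInf_le (hmem j m hm)
  exact ⟨h1, h2⟩

theorem isWaldschmidtConstant_of_le (hp : InGeneralPosition p) (hn : 1 ≤ n) (hs : 1 ≤ s)
    (hsn : s ≤ n) : IsWaldschmidtConstant (pointsIdeal (Set.range p)) 1 := by
  obtain ⟨L, hL, hL0, hLv⟩ := exists_hyperplane (fun i => (p i).rep) Finset.univ (by simp; omega)
  refine isWaldschmidtConstant_of_bounds hp hn (fun m t f hf hf0 h => ?_) hL hL0
    (fun i => hLv i (Finset.mem_univ i)) le_rfl (by simp)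
  rw [one_mul]
  exact_mod_cast (h ⟨0, hs⟩).le_degree hf hf0

theorem isWaldschmidtConstant_add_one {p : Fin (n + 1) → ℙ k (Fin (n + 1) → k)}
    (hp : InGeneralPosition p) (hn : 1 ≤ n) :
    IsWaldschmidtConstant (pointsIdeal (Set.range p)) (1 + 1 / (n : ℝ)) := by
  have hn' : (0 : ℝ) < n := by exact_mod_cast hn
  obtain ⟨F, hF, hF0, hFv⟩ := exists_form_basis hp.generalVectors Function.injective_id
  refine isWaldschmidtConstant_of_bounds hp hn (fun m t f hf hf0 h => ?_) hF hF0 hFv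
    (by simpa using hn) ?_
  · have := mul_le_of_vanishes_basis hp.generalVectors Function.injective_id hf hf0 h
    rw [Fintype.card_fin] at this
    have : ((n : ℝ) + 1) * m ≤ (n + 1 - 1) * t := by exact_mod_cast this
    field_simp
    linarith
  · simp
    field_simp
    rfl

theorem add_two_mul_le (hp : InGeneralPosition p) (hs : n + 2 ≤ s) (hn : 1 ≤ n) {m t : ℕ}
    {f : MvPolynomial (Fin (n + 1)) k} (hf : f.IsHomogeneous t) (hf0 : f ≠ 0)
    (h : ∀ i, VanishesToOrder (p i).rep m f) : (1 + 2 / (n : ℝ)) * m ≤ t := by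
  have hn' : (0 : ℝ) < n := by exact_mod_cast hn
  have := mul_le_of_vanishes_basis_add_one hp.generalVectors
    (e := Fin.castLE (show n + 1 ≤ s by omega)) (Fin.castLE_injective _) (a := ⟨n + 1, hs⟩)
    (fun i hi => by
      have := congrArg Fin.val hi
      simp at this
      omega) hf hf0 h
  rw [Fintype.card_fin] at this
  have : ((n : ℝ) + 1 + 1) * m ≤ (n + 1 - 1) * t := by exact_mod_cast this
  field_simp
  linarith

theorem isWaldschmidtConstant_add_two {p : Fin (n + 2) → ℙ k (Fin (n + 1) → k)}
    (hp : InGeneralPosition p) (hn : 1 ≤ n) :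
    IsWaldschmidtConstant (pointsIdeal (Set.range p)) (1 + 2 / (n : ℝ)) := by
  have hn' : (0 : ℝ) < n := by exact_mod_cast hn
  have hL : ∀ x : Fin (n + 2) × Fin (n + 2), ∃ L : MvPolynomial (Fin (n + 1)) k,
      x.1 ≠ x.2 → L.IsHomogeneous 1 ∧ L ≠ 0 ∧
        ∀ i, i ≠ x.1 → i ≠ x.2 → VanishesToOrder (p i).rep 1 L := by
    intro x
    by_cases hx : x.1 = x.2
    · exact ⟨0, fun h => absurd hx h⟩
    obtain ⟨L, hL, hL0, hLv⟩ := exists_hyperplane (fun i => (p i).rep) {x.1, x.2}ᶜ (by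
      rw [Finset.card_compl, Finset.card_pair hx]
      simp)
    exact ⟨L, fun _ => ⟨hL, hL0, fun i h1 h2 => hLv i (by simp [h1, h2])⟩⟩
  choose L hL using hL
  -- A hyperplane is indexed by the ordered pair of points it is not required to contain, so each
  -- set of `n` points is used twice.
  set D := (Finset.univ : Finset (Fin (n + 2))).offDiag
  have hD : ∀ x ∈ D, x.1 ≠ x.2 := fun x hx => (Finset.mem_offDiag.mp hx).2.2
  have hF : (∏ x ∈ D, L x).IsHomogeneous ((n + 2) * (n + 1)) := by
    have := IsHomogeneous.prod D L (fun _ => 1) fun x hx => (hL x (hD x hx)).1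
    convert this using 1
    rw [Finset.sum_const, Finset.offDiag_card, smul_eq_mul, mul_one, Finset.card_univ,
      Fintype.card_fin, Nat.mul_succ, Nat.mul_succ (n + 2) (n + 1), Nat.add_sub_cancel,
      Nat.mul_succ]
  have hF0 : ∏ x ∈ D, L x ≠ 0 := Finset.prod_ne_zero_iff.mpr fun x hx => (hL x (hD x hx)).2.1
  have hFv : ∀ i, VanishesToOrder (p i).rep ((n + 1) * n) (∏ x ∈ D, L x) := by
    intro i
    -- The factors known to vanish at the `i`-th point are those whose pair avoids `i`.
    set E := ((Finset.univ : Finset (Fin (n + 2))).erase i).offDiag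
    have hE : E ⊆ D := Finset.offDiag_mono (Finset.erase_subset _ _)
    have hcard : (n + 1) * n = E.card := by
      rw [Finset.offDiag_card, Finset.card_erase_of_mem (Finset.mem_univ i), Finset.card_univ,
        Fintype.card_fin, Nat.add_sub_cancel_right (n := n + 1) (m := 1), Nat.mul_succ,
        Nat.add_sub_cancel]
    rw [hcard]
    refine (VanishesToOrder.prod E L fun x hx => ?_).of_dvd (Finset.prod_dvd_prod_of_subset _ _ _ hE)
    have hx' := Finset.mem_offDiag.mp hx
    exact (hL x (hD x (hE hx))).2.2 i (Finset.ne_of_mem_erase hx'.1).symm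
      (Finset.ne_of_mem_erase hx'.2.1).symm
  refine isWaldschmidtConstant_of_bounds hp hn
    (fun m t f hf hf0 h => add_two_mul_le hp le_rfl hn hf hf0 h) hF hF0 hFv
    (Nat.mul_pos n.succ_pos hn) ?_
  push_cast
  field_simp
  linarith

theorem isWaldschmidtConstant_add_three_of_even {p : Fin (n + 3) → ℙ k (Fin (n + 1) → k)}
    (hp : InGeneralPosition p) (hn : 1 ≤ n) (heven : Even n) :
    IsWaldschmidtConstant (pointsIdeal (Set.range p)) (1 + 2 / (n : ℝ)) := by
  have hn' : (0 : ℝ) < n := by exact_mod_cast hn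
  obtain ⟨t, F, hF, hF0, ht, hFv⟩ := exists_form_of_odd hp.generalVectors (by simp)
    (by rw [Fintype.card_fin]; exact heven.add_odd (by decide))
  rw [Fintype.card_fin] at ht
  have ht' : 2 * t = n + 2 := by
    push_cast at ht
    omega
  obtain ⟨r, rfl⟩ : ∃ r, t = r + 1 := ⟨t - 1, by omega⟩
  refine isWaldschmidtConstant_of_bounds hp hn
    (fun m t f hf hf0 h => add_two_mul_le hp (by omega) hn hf hf0 h) hF hF0 hFv ?_ ?_
  · obtain ⟨j, rfl⟩ := heven
    omega
  · obtain rfl : n = 2 * r := by omega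
    have hr : (r : ℝ) ≠ 0 := by
      rintro h
      simp [h] at hn'
    have : (1 + 2 / ((2 * r : ℕ) : ℝ)) * (r : ℝ) = r + 1 := by
      push_cast
      field_simp
    rw [Nat.add_sub_cancel, this]
    simp

theorem isWaldschmidtConstant_add_three_of_odd {p : Fin (n + 3) → ℙ k (Fin (n + 1) → k)}
    (hp : InGeneralPosition p) (hn : 1 ≤ n) (hodd : Odd n) :
    IsWaldschmidtConstant (pointsIdeal (Set.range p))
      (1 + 2 / (n : ℝ) + 2 / ((n : ℝ) ^ 3 + 2 * (n : ℝ) ^ 2 - (n : ℝ))) := by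
  have hn' : (1 : ℝ) ≤ n := by exact_mod_cast hn
  have hpos : (0 : ℝ) < (n : ℝ) ^ 2 + 2 * n - 1 := by nlinarith
  have hc : 1 + 2 / (n : ℝ) + 2 / ((n : ℝ) ^ 3 + 2 * (n : ℝ) ^ 2 - (n : ℝ)) =
      (n + 1) * (n + 3) / ((n : ℝ) ^ 2 + 2 * n - 1) := by
    have : (n : ℝ) ^ 3 + 2 * (n : ℝ) ^ 2 - n = n * ((n : ℝ) ^ 2 + 2 * n - 1) := by ring
    rw [this]
    have h0 : (n : ℝ) ≠ 0 := by positivity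
    have h1 := hpos.ne'
    generalize hQ : (n : ℝ) ^ 2 + 2 * n - 1 = Q at h1
    field_simp
    linear_combination (-(n : ℝ) - 2) * hQ
  have heven : Even (Fintype.card (Fin (n + 3))) := by
    rw [Fintype.card_fin]
    exact hodd.add_odd (by decide)
  rw [hc]
  obtain ⟨t, F, hF, hF0, ht, hFv⟩ := exists_form_of_even hp.generalVectors (by simp) heven
  rw [Fintype.card_fin] at ht hFv
  push_cast at ht hFv
  -- The truncation is harmless: `2 t = (n + 1) (n + 3) ≥ 2 (n + 2)`.
  have hm : ((t - (n + 3 - 1) : ℤ).toNat : ℤ) = t - (n + 2) := by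
    rw [Int.toNat_of_nonneg]
    · ring
    · have : (1 : ℤ) ≤ n := by exact_mod_cast hn
      nlinarith
  refine isWaldschmidtConstant_of_bounds hp hn (fun m t f hf hf0 h => ?_) hF hF0 hFv ?_ ?_
  · have := mul_le_of_vanishes_of_even hp.generalVectors (by simp) heven hf hf0 h
    rw [Fintype.card_fin] at this
    have : ((n : ℝ) + 3) * (t - m) ≤ (n + 3 - 1) * ((n + 3) * (t - m) - 2 * t) := by
      exact_mod_cast this
    rw [div_mul_eq_mul_div, div_le_iff₀ hpos]
    linarith
  · zify
    rw [hm]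
    have : (1 : ℤ) ≤ n := by exact_mod_cast hn
    nlinarith
  · have hm' : (((t - (n + 3 - 1) : ℤ).toNat : ℕ) : ℝ) = t - (n + 2) := by exact_mod_cast hm
    have ht' : 2 * (t : ℝ) = (n + 3) * (n + 3 - 1) - (n + 3) := by exact_mod_cast ht
    have ht'' : (t : ℝ) = (n + 1) * (n + 3) / 2 := by linarith
    rw [hm', ht'', div_mul_eq_mul_div, le_div_iff₀ hpos]
    linarith

end PointsIdeal

end Waldschmidt

theorem mainTheorem7 {k : Type*} [Field k] [IsAlgClosed k] (n s : ℕ) (hn : 1 ≤ n) (hs : 1 ≤ s)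
    (p : Fin s → ℙ k (Fin (n + 1) → k)) (hp : Waldschmidt.InGeneralPosition p) :
    (s ≤ n →
      Waldschmidt.IsWaldschmidtConstant (Waldschmidt.pointsIdeal (Set.range p)) 1) ∧
    (s = n + 1 →
      Waldschmidt.IsWaldschmidtConstant (Waldschmidt.pointsIdeal (Set.range p))
        (1 + 1 / (n : ℝ))) ∧
    (s = n + 2 →
      Waldschmidt.IsWaldschmidtConstant (Waldschmidt.pointsIdeal (Set.range p))
        (1 + 2 / (n : ℝ))) ∧
    (s = n + 3 → Even n →
      Waldschmidt.IsWaldschmidtConstant (Waldschmidt.pointsIdeal (Set.range p))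
        (1 + 2 / (n : ℝ))) ∧
    (s = n + 3 → Odd n →
      Waldschmidt.IsWaldschmidtConstant (Waldschmidt.pointsIdeal (Set.range p))
        (1 + 2 / (n : ℝ) + 2 / ((n : ℝ) ^ 3 + 2 * (n : ℝ) ^ 2 - (n : ℝ)))) := by
  refine ⟨fun h => Waldschmidt.isWaldschmidtConstant_of_le hp hn hs h, ?_, ?_, ?_, ?_⟩
  · rintro rfl
    exact Waldschmidt.isWaldschmidtConstant_add_one hp hn
  · rintro rfl
    exact Waldschmidt.isWaldschmidtConstant_add_two hp hn
  · rintro rfl heven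
    exact Waldschmidt.isWaldschmidtConstant_add_three_of_even hp hn heven
  · rintro rfl hodd
    exact Waldschmidt.isWaldschmidtConstant_add_three_of_odd hp hn hodd
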